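/- Let $E$ be an infinite-dimensional real Banach space that has an unconditional Schauder basis $\{e_n\}_{n\in\mathbb N}$ and that admits an equivalent norm $N$ which is of class $C^1$ on $E\setminus\{0\}$ and locally depends on finitely many coordinates, that is: for every $x\in E\setminus\{0\}$ there are an open neighbourhood $V_x$ of $x$, a natural number $l_x$, continuous linear functionals $L_1,\dots,L_{l_x}\in E^*$ and a function $\gamma:\mathbb R^{l_x}\to\mathbb R$ such that $N(y)=\gamma(L_1(y),\dots,L_{l_x}(y))$ for every $y\in V_x$. Let $d$ be a natural number, $U\subseteq E$ an open set, $f:U\to\mathbb R^d$ a $C^1$ function and $\varepsilon:U\to(0,\infty)$ a continuous function. Then there exists a $C^1$ function $g:U\to\mathbb R^d$ such that 1. $\|f(x)-g(x)\|\le\varepsilon(x)$ for every $x\in U$; 2. $\|Df(x)-Dg(x)\|\le\varepsilon(x)$ for every $x\in U$; 3. $C_g=\emptyset$, where $C_g:=\{x\in U:\ Dg(x) \text{ is not surjective}\}$, i.e. $g$ has no critical points. Here $\mathbb R^d$ carries the Euclidean norm, $Df(x),Dg(x):E\to\mathbb R^d$ are the Fréchet derivatives, and $\|Df(x)-Dg(x)\|$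 is the operator norm. -/

import Mathlib

open Set Filter Topology

/-- A seminorm `N` on a normed space `E` is an equivalent norm if it is bounded above and below by
positive multiples of the given norm of `E` (so it is a norm, inducing the same topology). -/
def IsEquivalentNorm {E : Type*} [NormedAddCommGroup E] [NormedSpace ℝ E]
    (N : Seminorm ℝ E) : Prop :=
  ∃ c C : ℝ, 0 < c ∧ 0 < C ∧ ∀ x : E, c * ‖x‖ ≤ N x ∧ N x ≤ C * ‖x‖

/-- A norm is of class `C¹` if it is continuously differentiable away from the origin
(no norm on a nontrivial space is differentiable at the origin). -/
def IsC1Norm {E : Type*} [NormedAddCommGroup E] [NormedSpace ℝ E]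
    (N : Seminorm ℝ E) : Prop :=
  ContDiffOn ℝ 1 (fun x : E => N x) {0}ᶜ

/-- A norm `N` locally depends on finitely many coordinates if near every nonzero point `x` it is
a function of finitely many continuous linear functionals.  The origin has to be left out: in an
infinite-dimensional space no norm is of this form near the origin, because it would vanish on the
intersection of the kernels of the functionals. -/
def LocallyDependsOnFinitelyManyCoordinates {E : Type*} [NormedAddCommGroup E] [NormedSpace ℝ E]
    (N : Seminorm ℝ E) : Prop :=
  ∀ x : E, x ≠ 0 → ∃ (l : ℕ) (V : Set E) (L : Fin l → E →L[ℝ] ℝ) (γ : (Fin l → ℝ) → ℝ),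
    IsOpen V ∧ x ∈ V ∧ ∀ y ∈ V, N y = γ (fun i => L i y)

/-- The set of critical points in `U` of a map `g` defined on `U`: the points at which the
Fréchet derivative is not surjective. -/
def criticalSet {E F : Type*} [NormedAddCommGroup E] [NormedSpace ℝ E]
    [NormedAddCommGroup F] [NormedSpace ℝ F] (g : E → F) (U : Set E) : Set E :=
  {x | x ∈ U ∧ ¬ Function.Surjective (fderiv ℝ g x)}

/-!
Multiplying the `n`-th coordinate of `x` by a cutoff of the `n`-th tail of `x`, and rescaling,
yields `C¹` maps `Ψ` uniformly close to the identity whose derivatives are uniformly bounded and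
have all their components in a fixed countably generated space `M ⊆ E*`, spanned by the coordinate
functionals and the differentials of the norm.  Near a point where `Df` is close to `A`, the map
`f ∘ Ψ + A ∘ (id - Ψ)` is `C¹`-close to `f`, and its derivative agrees with `A` modulo operators
with components in `M`.  Gluing countably many such maps by a partition of unity whose
differentials lie in `M` gives an approximation `g` of `f` all of whose derivatives have their
components in one countably generated space.  As `E*` is an infinite-dimensional Banach space, its
algebraic dimension is uncountable, so some operator `T` is independent modulo that space.  For a
small positive function `ρ` with differentials in `M`, the derivative of `g + ρ • T` is `ρ • T`
modulo the space, hence is surjective everywhere.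
-/

section Components

variable {E F G : Type*} [NormedAddCommGroup E] [NormedSpace ℝ E]
  [NormedAddCommGroup F] [NormedSpace ℝ F] [NormedAddCommGroup G] [NormedSpace ℝ G]

/-- The operators all of whose components, i.e. compositions with a continuous linear functional
on the target, belong to the space `M` of functionals. -/
def componentsIn (F : Type*) [NormedAddCommGroup F] [NormedSpace ℝ F]
    (M : Submodule ℝ (E →L[ℝ] ℝ)) : Submodule ℝ (E →L[ℝ] F) where
  carrier := {T | ∀ l : F →L[ℝ] ℝ, l.comp T ∈ M}
  add_mem' hS hT l := by simpa only [ContinuousLinearMap.comp_add] using M.add_mem (hS l) (hT l)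
  zero_mem' l := by simp only [ContinuousLinearMap.comp_zero, zero_mem]
  smul_mem' c _ hT l := by
    simpa only [ContinuousLinearMap.comp_smul] using M.smul_mem c (hT l)

/-- The operator `T` is independent modulo the space `M` of functionals if none of its nontrivial
components belongs to `M`. -/
def IndependentMod (M : Submodule ℝ (E →L[ℝ] ℝ)) (T : E →L[ℝ] F) : Prop :=
  ∀ l : F →L[ℝ] ℝ, l.comp T ∈ M → l = 0

variable {M M' : Submodule ℝ (E →L[ℝ] ℝ)}

theorem componentsIn_mono (h : M ≤ M') : componentsIn F M ≤ componentsIn F M' :=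
  fun _ hT l => h (hT l)

theorem smulRight_mem_componentsIn {φ : E →L[ℝ] ℝ} (hφ : φ ∈ M) (v : F) :
    φ.smulRight v ∈ componentsIn F M := fun l => by
  have : l.comp (φ.smulRight v) = l v • φ := by
    ext x
    simp [mul_comm]
  exact this ▸ M.smul_mem _ hφ

theorem comp_mem_componentsIn {T : E →L[ℝ] F} (hT : T ∈ componentsIn F M) (A : F →L[ℝ] G) :
    A.comp T ∈ componentsIn G M :=
  fun l => hT (l.comp A)

theorem exists_countable_subset_componentsIn_span [FiniteDimensional ℝ F] {D : Set (E →L[ℝ] F)}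
    (hD : D.Countable) :
    ∃ s : Set (E →L[ℝ] ℝ), s.Countable ∧ D ⊆ componentsIn F (Submodule.span ℝ s) := by
  let v := Module.finBasis ℝ F
  let coord i : F →L[ℝ] ℝ := LinearMap.toContinuousLinearMap (v.coord i)
  refine ⟨⋃ i, (fun T => (coord i).comp T) '' D, countable_iUnion fun i => hD.image _,
    fun T hT => ?_⟩
  have hT_eq : T = ∑ i, ((coord i).comp T).smulRight (v i) := by
    ext x
    simp [coord]
  rw [hT_eq]
  exact Submodule.sum_mem _ fun i _ => smulRight_mem_componentsIn
    (Submodule.subset_span (mem_iUnion.2 ⟨i, mem_image_of_mem _ hT⟩)) _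

theorem surjective_of_sub_smul_mem_componentsIn [FiniteDimensional ℝ F] {T D : E →L[ℝ] F} {ρ : ℝ}
    (hρ : ρ ≠ 0) (hT : IndependentMod M T) (hD : D - ρ • T ∈ componentsIn F M) :
    Function.Surjective D := by
  by_contra hns
  have hlt : LinearMap.range (D : E →ₗ[ℝ] F) < ⊤ :=
    lt_top_iff_ne_top.2 fun h => hns (LinearMap.range_eq_top.1 h)
  obtain ⟨l, hl0, hl⟩ := Submodule.exists_le_ker_of_lt_top _ hlt
  let l' : F →L[ℝ] ℝ := LinearMap.toContinuousLinearMap l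
  have hlD : l'.comp D = 0 := by
    ext x
    exact hl (LinearMap.mem_range_self (D : E →ₗ[ℝ] F) x)
  have hlT : l'.comp T ∈ M := by
    have h := hD l'
    rwa [ContinuousLinearMap.comp_sub, hlD, zero_sub, ContinuousLinearMap.comp_smul,
      Submodule.neg_mem_iff, Submodule.smul_mem_iff _ hρ] at h
  exact hl0 (LinearMap.toContinuousLinearMap.map_eq_zero_iff.1 (hT l' hlT))

end Components

section Independence

theorem span_ne_top_of_countable {V : Type*} [NormedAddCommGroup V] [NormedSpace ℝ V]
    [CompleteSpace V] (hV : ¬ FiniteDimensional ℝ V) {s : Set V} (hs : s.Countable) :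
    Submodule.span ℝ s ≠ ⊤ := by
  intro hspan
  have : Countable s := hs.to_subtype
  classical
  let W : Finset s → Submodule ℝ V := fun t => Submodule.span ℝ (t.image Subtype.val : Finset V)
  have hW : ⋃ t, (W t : Set V) = univ := by
    refine eq_univ_of_forall fun v => ?_
    obtain ⟨t, hts, hv⟩ := Submodule.mem_span_finite_of_mem_span (hspan ▸ Submodule.mem_top : v ∈ _)
    refine mem_iUnion.2 ⟨t.subtype (· ∈ s), Submodule.span_mono (fun w hw => ?_) hv⟩
    simpa using ⟨hw, hts hw⟩
  obtain ⟨t, ht⟩ := nonempty_interior_of_iUnion_of_closed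
    (fun t => (W t).closed_of_finiteDimensional) hW
  have htop : W t = ⊤ := (W t).eq_top_of_nonempty_interior' ht
  exact hV (Module.finite_def.2 (htop ▸ Submodule.fg_span (Finset.finite_toSet _)))

theorem not_finiteDimensional_quotient_span {V : Type*} [NormedAddCommGroup V] [NormedSpace ℝ V]
    [CompleteSpace V] (hV : ¬ FiniteDimensional ℝ V) {s : Set V} (hs : s.Countable) :
    ¬ FiniteDimensional ℝ (V ⧸ Submodule.span ℝ s) := by
  intro hfin
  obtain ⟨W, hW⟩ := (Submodule.span ℝ s).exists_isCompl
  have : FiniteDimensional ℝ W := (Submodule.quotientEquivOfIsCompl _ W hW).finiteDimensional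
  obtain ⟨t, rfl⟩ := (Submodule.fg_iff_finiteDimensional W).2 this
  refine span_ne_top_of_countable hV (hs.union t.countable_toSet) ?_
  rw [Submodule.span_union, hW.sup_eq_top]

theorem not_finiteDimensional_dual {E : Type*} [NormedAddCommGroup E] [NormedSpace ℝ E]
    (hE : ¬ FiniteDimensional ℝ E) : ¬ FiniteDimensional ℝ (E →L[ℝ] ℝ) := fun _ => hE <|
  FiniteDimensional.of_injective (NormedSpace.inclusionInDoubleDualLi ℝ (E := E)).toLinearMap
    (NormedSpace.inclusionInDoubleDualLi ℝ (E := E)).injective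

theorem exists_independentMod_span {E : Type*} [NormedAddCommGroup E] [NormedSpace ℝ E]
    (hE : ¬ FiniteDimensional ℝ E) (F : Type*) [NormedAddCommGroup F] [NormedSpace ℝ F]
    [FiniteDimensional ℝ F] {s : Set (E →L[ℝ] ℝ)} (hs : s.Countable) :
    ∃ T : E →L[ℝ] F, IndependentMod (Submodule.span ℝ s) T := by
  let v := Module.finBasis ℝ F
  let Q := (E →L[ℝ] ℝ) ⧸ Submodule.span ℝ s
  have hQ : Cardinal.aleph0 ≤ Module.rank ℝ Q := not_lt.1 fun h =>
    not_finiteDimensional_quotient_span (not_finiteDimensional_dual hE) hs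
      (Module.rank_lt_aleph0_iff.1 h)
  obtain ⟨q, hq⟩ := Module.le_rank_iff.1
    ((Cardinal.natCast_le_aleph0 (n := Module.finrank ℝ F)).trans hQ)
  choose t ht using fun i => Submodule.mkQ_surjective (Submodule.span ℝ s) (q i)
  refine ⟨∑ i, (t i).smulRight (v i), fun l hl => ?_⟩
  have hcomp : l.comp (∑ i, (t i).smulRight (v i)) = ∑ i, l (v i) • t i := by
    ext x
    simp [mul_comm]
  have hsum : ∑ i, l (v i) • q i = 0 := by
    rw [hcomp, ← Submodule.Quotient.mk_eq_zero, ← Submodule.mkQ_apply, map_sum] at hl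
    simpa only [map_smul, ht] using hl
  exact ContinuousLinearMap.coe_injective
    (v.ext fun i => by simpa using Fintype.linearIndependent_iff.1 hq _ hsum i)

end Independence

section FinitelyManyCoordinates

variable {E : Type*} [NormedAddCommGroup E] [NormedSpace ℝ E]

theorem mem_span_range_of_forall_eq_zero {ι : Type*} [Finite ι] (L : ι → E →L[ℝ] ℝ)
    (φ : E →L[ℝ] ℝ) (h : ∀ w, (∀ i, L i w = 0) → φ w = 0) :
    φ ∈ Submodule.span ℝ (range L) := by
  let toLinear : (E →L[ℝ] ℝ) →ₗ[ℝ] E →ₗ[ℝ] ℝ := ContinuousLinearMap.coeLM ℝ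
  have hφ : toLinear φ ∈ Submodule.span ℝ (range fun i => toLinear (L i)) :=
    mem_span_of_iInf_ker_le_ker fun w hw => by
      simp only [Submodule.mem_iInf, LinearMap.mem_ker] at hw ⊢
      exact h w hw
  rw [range_comp' toLinear L, Submodule.span_image] at hφ
  obtain ⟨ψ, hψ, hψφ⟩ := hφ
  rwa [← ContinuousLinearMap.coe_injective hψφ]

theorem fderiv_mem_span_range_of_eventuallyEq {ι : Type*} [Finite ι] {N : E → ℝ} {z : E}
    (hd : DifferentiableAt ℝ N z) (L : ι → E →L[ℝ] ℝ) (γ : (ι → ℝ) → ℝ)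
    (hN : ∀ᶠ y in 𝓝 z, N y = γ fun i => L i y) :
    fderiv ℝ N z ∈ Submodule.span ℝ (range L) := by
  refine mem_span_range_of_forall_eq_zero L _ fun w hw => ?_
  have hline : HasDerivAt (fun t : ℝ => N (z + t • w)) (fderiv ℝ N z w) 0 :=
    hd.hasFDerivAt.hasLineDerivAt w
  have htendsto : Tendsto (fun t : ℝ => z + t • w) (𝓝 0) (𝓝 z) := by
    simpa using (show Continuous fun t : ℝ => z + t • w by fun_prop).tendsto 0
  have hconst : (fun t : ℝ => N (z + t • w)) =ᶠ[𝓝 0] fun _ => N z := by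
    filter_upwards [htendsto.eventually hN] with t ht
    rw [ht, hN.self_of_nhds]
    simp [hw]
  exact hline.unique ((hasDerivAt_const (0 : ℝ) (N z)).congr_of_eventuallyEq hconst)

theorem IsC1Norm.contDiffAt {N : Seminorm ℝ E} (hN : IsC1Norm N) {z : E} (hz : z ≠ 0) :
    ContDiffAt ℝ 1 (fun x => N x) z :=
  ContDiffOn.contDiffAt hN (isOpen_compl_singleton.mem_nhds hz)

theorem LocallyDependsOnFinitelyManyCoordinates.exists_countable_fderiv_mem_span
    [SecondCountableTopology E] {N : Seminorm ℝ E} (hN : IsC1Norm N)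
    (hL : LocallyDependsOnFinitelyManyCoordinates N) :
    ∃ s : Set (E →L[ℝ] ℝ), s.Countable ∧
      ∀ z, z ≠ 0 → fderiv ℝ (fun x => N x) z ∈ Submodule.span ℝ s := by
  choose! l V L γ hV hxV hγ using hL
  obtain ⟨t, ht0, htc, hcover⟩ := TopologicalSpace.countable_cover_nhdsWithin (f := V)
    fun x (hx : x ∈ ({0}ᶜ : Set E)) =>
      mem_nhdsWithin_of_mem_nhds ((hV x hx).mem_nhds (hxV x hx))
  refine ⟨⋃ x ∈ t, range (L x), htc.biUnion fun x _ => countable_range _, fun z hz => ?_⟩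
  obtain ⟨x, hxt, hzx⟩ := mem_iUnion₂.1 (hcover hz)
  refine Submodule.span_mono (subset_biUnion_of_mem (u := fun x => range (L x)) hxt) ?_
  exact fderiv_mem_span_range_of_eventuallyEq ((hN.contDiffAt hz).differentiableAt one_ne_zero)
    (L x) (γ x) (eventually_of_mem ((hV x (ht0 hxt)).mem_nhds hzx) (hγ x (ht0 hxt)))

theorem norm_fderiv_seminorm_le {N : Seminorm ℝ E} {C : ℝ} (hC : 0 ≤ C)
    (hN : ∀ x, N x ≤ C * ‖x‖) (z : E) : ‖fderiv ℝ (fun x => N x) z‖ ≤ C :=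
  norm_fderiv_le_of_lip' ℝ hC <| Eventually.of_forall fun y =>
    (abs_sub_map_le_sub N y z).trans (hN (y - z))

end FinitelyManyCoordinates

section Weights

variable {E : Type*} [NormedAddCommGroup E] [NormedSpace ℝ E]

/-- A `C¹` function with values in `[0, 1]` and bounded derivative, all of whose differentials
belong to the space `M` of functionals.  Such functions serve as weights for gluing. -/
structure IsC1Weight (M : Submodule ℝ (E →L[ℝ] ℝ)) (φ : E → ℝ) : Prop where
  contDiff : ContDiff ℝ 1 φ
  nonneg : ∀ x, 0 ≤ φ x
  le_one : ∀ x, φ x ≤ 1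
  exists_norm_fderiv_le : ∃ K, ∀ x, ‖fderiv ℝ φ x‖ ≤ K
  fderiv_mem : ∀ x, fderiv ℝ φ x ∈ M

namespace IsC1Weight

variable {M : Submodule ℝ (E →L[ℝ] ℝ)} {φ ψ : E → ℝ}

protected theorem hasFDerivAt (hφ : IsC1Weight M φ) (x : E) : HasFDerivAt φ (fderiv ℝ φ x) x :=
  (hφ.contDiff.differentiable one_ne_zero x).hasFDerivAt

theorem one : IsC1Weight M fun _ => 1 where
  contDiff := contDiff_const
  nonneg _ := zero_le_one
  le_one _ := le_rfl
  exists_norm_fderiv_le := ⟨0, fun x => by simp⟩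
  fderiv_mem x := by simp

theorem one_sub (hφ : IsC1Weight M φ) : IsC1Weight M fun x => 1 - φ x where
  contDiff := contDiff_const.sub hφ.contDiff
  nonneg x := sub_nonneg.2 (hφ.le_one x)
  le_one x := sub_le_self 1 (hφ.nonneg x)
  exists_norm_fderiv_le := by simpa [fderiv_const_sub] using hφ.exists_norm_fderiv_le
  fderiv_mem x := by simpa [fderiv_const_sub] using hφ.fderiv_mem x

theorem mul (hφ : IsC1Weight M φ) (hψ : IsC1Weight M ψ) : IsC1Weight M fun x => φ x * ψ x := by
  have hd x : fderiv ℝ (fun x => φ x * ψ x) x = φ x • fderiv ℝ ψ x + ψ x • fderiv ℝ φ x :=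
    ((hφ.hasFDerivAt x).mul (hψ.hasFDerivAt x)).fderiv
  obtain ⟨K, hK⟩ := hφ.exists_norm_fderiv_le
  obtain ⟨L, hL⟩ := hψ.exists_norm_fderiv_le
  refine ⟨hφ.contDiff.mul hψ.contDiff, fun x => mul_nonneg (hφ.nonneg x) (hψ.nonneg x),
    fun x => mul_le_one₀ (hφ.le_one x) (hψ.nonneg x) (hψ.le_one x), ⟨L + K, fun x => ?_⟩,
    fun x => ?_⟩
  · rw [hd]
    refine norm_add_le_of_le ?_ ?_ <;> rw [norm_smul]
    · rw [Real.norm_of_nonneg (hφ.nonneg x)]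
      exact (mul_le_of_le_one_left (norm_nonneg _) (hφ.le_one x)).trans (hL x)
    · rw [Real.norm_of_nonneg (hψ.nonneg x)]
      exact (mul_le_of_le_one_left (norm_nonneg _) (hψ.le_one x)).trans (hK x)
  · rw [hd]
    exact M.add_mem (M.smul_mem _ (hψ.fderiv_mem x)) (M.smul_mem _ (hφ.fderiv_mem x))

theorem prod {τ : ℕ → E → ℝ} (hτ : ∀ n, IsC1Weight M (τ n)) (n : ℕ) :
    IsC1Weight M fun x => ∏ j ∈ Finset.range n, τ j x := by
  induction n with
  | zero => simpa using one
  | succ n ih => simpa only [Finset.prod_range_succ] using ih.mul (hτ n)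

theorem comp_smul_sub (hφ : IsC1Weight M φ) (c : ℝ) (p : E) :
    IsC1Weight M fun x => φ (c • (x - p)) := by
  have hd x : fderiv ℝ (fun x => φ (c • (x - p))) x = c • fderiv ℝ φ (c • (x - p)) := by
    have := (hφ.hasFDerivAt (c • (x - p))).comp x (((hasFDerivAt_id x).sub_const p).const_smul c)
    rw [ContinuousLinearMap.comp_smul, ContinuousLinearMap.comp_id] at this
    exact this.fderiv
  obtain ⟨K, hK⟩ := hφ.exists_norm_fderiv_le
  refine ⟨hφ.contDiff.comp ((contDiff_id.sub contDiff_const).const_smul c), fun x => hφ.nonneg _,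
    fun x => hφ.le_one _, ⟨‖c‖ * K, fun x => ?_⟩, fun x => ?_⟩
  · rw [hd, norm_smul]
    gcongr
    exact hK _
  · exact hd x ▸ M.smul_mem c (hφ.fderiv_mem _)

end IsC1Weight

/-- A `C¹` weight that vanishes on the ball of radius `a` around the origin and is equal to `1`
off the open unit ball. -/
structure IsCutoff (M : Submodule ℝ (E →L[ℝ] ℝ)) (θ : E → ℝ) (a : ℝ) : Prop
    extends IsC1Weight M θ where
  pos : 0 < a
  eq_zero : ∀ z, ‖z‖ < a → θ z = 0
  eq_one : ∀ z, 1 ≤ ‖z‖ → θ z = 1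

theorem IsCutoff.fderiv_eq_zero {M : Submodule ℝ (E →L[ℝ] ℝ)} {θ : E → ℝ} {a : ℝ}
    (hθ : IsCutoff M θ a) {z : E} (hz : 1 < ‖z‖) : fderiv ℝ θ z = 0 := by
  have : θ =ᶠ[𝓝 z] fun _ => 1 := by
    filter_upwards [continuous_norm.continuousAt.eventually (lt_mem_nhds hz)] with y hy
    exact hθ.eq_one y hy.le
  rw [this.fderiv_eq, fderiv_fun_const, Pi.zero_apply]

theorem exists_norm_deriv_smoothTransition_le :
    ∃ S : ℝ, ∀ t, ‖deriv Real.smoothTransition t‖ ≤ S := by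
  have hcont : Continuous (deriv Real.smoothTransition) :=
    (Real.smoothTransition.contDiff (n := 1)).continuous_deriv le_rfl
  refine hcont.bounded_above_of_compact_support
    (HasCompactSupport.of_support_subset_isCompact (isCompact_Icc (a := 0) (b := 1)) ?_)
  intro t ht
  by_contra hmem
  refine ht ?_
  rcases not_and_or.1 hmem with h | h <;> rw [not_le] at h
  · have hmin : IsLocalMin Real.smoothTransition t := Eventually.of_forall fun y =>
      (Real.smoothTransition.zero_of_nonpos h.le).trans_le (Real.smoothTransition.nonneg y)
    exact hmin.deriv_eq_zero
  · have hmax : IsLocalMax Real.smoothTransition t := Eventually.of_forall fun y =>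
      (Real.smoothTransition.le_one y).trans_eq (Real.smoothTransition.one_of_one_le h.le).symm
    exact hmax.deriv_eq_zero

theorem isC1Weight_smoothTransition_comp {M : Submodule ℝ (E →L[ℝ] ℝ)} {p : E → ℝ} {K : ℝ}
    (hp : ∀ z, (∀ᶠ y in 𝓝 z, p y ≤ 0) ∨
      (ContDiffAt ℝ 1 p z ∧ ‖fderiv ℝ p z‖ ≤ K ∧ fderiv ℝ p z ∈ M)) :
    IsC1Weight M fun z => Real.smoothTransition (p z) := by
  obtain ⟨S, hS⟩ := exists_norm_deriv_smoothTransition_le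
  have hzero {z} (hz : ∀ᶠ y in 𝓝 z, p y ≤ 0) :
      (fun y => Real.smoothTransition (p y)) =ᶠ[𝓝 z] fun _ => 0 :=
    hz.mono fun y hy => Real.smoothTransition.zero_of_nonpos hy
  have hfderiv z : fderiv ℝ (fun y => Real.smoothTransition (p y)) z = 0 ∨
      ‖fderiv ℝ p z‖ ≤ K ∧ fderiv ℝ p z ∈ M ∧ fderiv ℝ (fun y => Real.smoothTransition (p y)) z =
        deriv Real.smoothTransition (p z) • fderiv ℝ p z := by
    refine (hp z).imp (fun hz => ?_) fun ⟨hd, hK, hM⟩ => ⟨hK, hM, ?_⟩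
    · rw [(hzero hz).fderiv_eq, fderiv_fun_const, Pi.zero_apply]
    · exact (((Real.smoothTransition.contDiff (n := 1)).differentiable one_ne_zero
        (p z)).hasDerivAt.comp_hasFDerivAt z (hd.differentiableAt one_ne_zero).hasFDerivAt).fderiv
  refine ⟨contDiff_iff_contDiffAt.2 fun z => ?_, fun z => Real.smoothTransition.nonneg _,
    fun z => Real.smoothTransition.le_one _, ⟨max 0 (S * K), fun z => ?_⟩, fun z => ?_⟩
  · rcases hp z with hz | ⟨hd, -⟩
    · exact contDiffAt_const.congr_of_eventuallyEq (hzero hz)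
    · exact Real.smoothTransition.contDiffAt.comp z hd
  · rcases hfderiv z with h | ⟨hK, -, h⟩ <;> rw [h]
    · simp
    · rw [norm_smul]
      exact le_max_of_le_right
        (mul_le_mul (hS _) hK (norm_nonneg _) ((norm_nonneg _).trans (hS 0)))
  · rcases hfderiv z with h | ⟨-, hM, h⟩ <;> rw [h]
    · exact zero_mem M
    · exact M.smul_mem _ hM

theorem exists_isCutoff {N : Seminorm ℝ E} (hE : IsEquivalentNorm N) (hN : IsC1Norm N)
    {M : Submodule ℝ (E →L[ℝ] ℝ)} (hM : ∀ z, z ≠ 0 → fderiv ℝ (fun x => N x) z ∈ M) :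
    ∃ θ a, IsCutoff M θ a := by
  obtain ⟨c, C, hc, hC, hcC⟩ := hE
  let p : E → ℝ := fun z => 2 / c * N z - 1
  have hnonpos z (hz : ‖z‖ < c / (2 * C)) : p z ≤ 0 := by
    have : N z ≤ c / 2 := calc
      N z ≤ C * ‖z‖ := (hcC z).2
      _ ≤ C * (c / (2 * C)) := by gcongr
      _ = c / 2 := by field_simp
    calc p z ≤ 2 / c * (c / 2) - 1 := by simp only [p]; gcongr
      _ = 0 := by field_simp; ring
  have hone_le z (hz : 1 ≤ ‖z‖) : 1 ≤ p z := by
    have : c ≤ N z := (le_mul_of_one_le_right hc.le hz).trans (hcC z).1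
    calc 1 = 2 / c * c - 1 := by field_simp; ring
      _ ≤ p z := by simp only [p]; gcongr
  have hpos : 0 < c / (2 * C) := by positivity
  refine ⟨fun z => Real.smoothTransition (p z), c / (2 * C),
    isC1Weight_smoothTransition_comp (K := 2 / c * C) fun z => ?_, hpos,
    fun z hz => Real.smoothTransition.zero_of_nonpos (hnonpos z hz),
    fun z hz => Real.smoothTransition.one_of_one_le (hone_le z hz)⟩
  rcases eq_or_ne z 0 with rfl | hz
  · left
    filter_upwards [Metric.ball_mem_nhds (0 : E) hpos] with y hy
    exact hnonpos y (mem_ball_zero_iff.1 hy)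
  · have hfderiv : fderiv ℝ p z = (2 / c) • fderiv ℝ (fun x => N x) z :=
      ((((hN.contDiffAt hz).differentiableAt one_ne_zero).hasFDerivAt.const_mul
        (2 / c)).sub_const 1).fderiv
    refine .inr ⟨(contDiffAt_const.mul (hN.contDiffAt hz)).sub contDiffAt_const, ?_, ?_⟩ <;>
      rw [hfderiv]
    · rw [norm_smul, Real.norm_of_nonneg (by positivity)]
      gcongr
      exact norm_fderiv_seminorm_le hC.le (fun x => (hcC x).2) z
    · exact M.smul_mem _ (hM z hz)

end Weights

section Damping

variable {E : Type*} [NormedAddCommGroup E] [NormedSpace ℝ E]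

theorem norm_sum_smul_le_of_forall_subset {ι : Type*} {s : Finset ι} {v : ι → E} {c : ι → ℝ}
    {R B : ℝ} (hv : ∀ t ⊆ s, ‖∑ i ∈ t, v i‖ ≤ R) (hB : 0 ≤ B) (hc : ∀ i ∈ s, |c i| ≤ B) :
    ‖∑ i ∈ s, c i • v i‖ ≤ 2 * R * B := by
  obtain ⟨g, hg, hgw⟩ := exists_dual_vector'' ℝ (∑ i ∈ s, c i • v i)
  have hgt (t) (ht : t ⊆ s) : |∑ i ∈ t, g (v i)| ≤ R := by
    rw [← map_sum]
    exact (g.le_of_opNorm_le hg _).trans ((one_mul _).trans_le (hv t ht))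
  -- the terms with `g (v i) ≥ 0` and those with `g (v i) < 0` each contribute at most `R`
  have habs : ∑ i ∈ s, |g (v i)| ≤ 2 * R := by
    classical
    rw [← Finset.sum_filter_add_sum_filter_not s fun i => 0 ≤ g (v i),
      Finset.sum_congr rfl fun i hi => abs_of_nonneg (Finset.mem_filter.1 hi).2,
      Finset.sum_congr rfl fun i hi => abs_of_neg (not_le.1 (Finset.mem_filter.1 hi).2),
      Finset.sum_neg_distrib]
    linarith [(abs_le.1 (hgt _ (Finset.filter_subset (fun i => 0 ≤ g (v i)) s))).2,
      (abs_le.1 (hgt _ (Finset.filter_subset (fun i => ¬ 0 ≤ g (v i)) s))).1]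
  calc ‖∑ i ∈ s, c i • v i‖ = ∑ i ∈ s, c i * g (v i) := by
        simpa using hgw.symm
    _ ≤ ∑ i ∈ s, B * |g (v i)| := Finset.sum_le_sum fun i hi =>
        (le_abs_self _).trans ((abs_mul _ _).trans_le (by gcongr; exact hc i hi))
    _ ≤ 2 * R * B := by
        rw [← Finset.mul_sum, mul_comm _ B]
        gcongr

theorem norm_sum_smul_coord_smul_le [CompleteSpace E] {ι : Type*}
    (b : UnconditionalSchauderBasis ι ℝ E) {s : Finset ι} {c : ι → ℝ} {B : ℝ} (hB : 0 ≤ B)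
    (hc : ∀ i ∈ s, |c i| ≤ B) (x : E) :
    ‖∑ i ∈ s, c i • b.coord i x • b i‖ ≤ 2 * b.nnnormProjBound * B * ‖x‖ := by
  refine (norm_sum_smul_le_of_forall_subset (R := b.nnnormProjBound * ‖x‖) (fun t _ => ?_)
    hB hc).trans_eq (by ring)
  rw [← b.proj_apply]
  exact (b.proj t).le_of_opNorm_le (b.norm_proj_le_nnnormProjBound t) x

variable (b : UnconditionalSchauderBasis ℕ ℝ E)

/-- The projection onto the closed span of the basis vectors of index at least `n`. -/
noncomputable def tailProj (n : ℕ) : E →L[ℝ] E :=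
  ContinuousLinearMap.id ℝ E - b.proj (Finset.range n)

theorem tailProj_apply (n : ℕ) (x : E) :
    tailProj b n x = x - ∑ k ∈ Finset.range n, b.coord k x • b k := by
  simp [tailProj]

theorem tendsto_tailProj (x : E) : Tendsto (fun n => tailProj b n x) atTop (𝓝 0) := by
  simpa [tailProj_apply] using (tendsto_const_nhds (x := x)).sub (b.expansion x).tendsto_sum_nat

theorem coord_tailProj {n k : ℕ} (h : n ≤ k) (x : E) :
    b.coord k (tailProj b n x) = b.coord k x := by
  have hsum : ∑ i ∈ Finset.range n, b.coord i x • b.coord k (b i) = 0 :=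
    Finset.sum_eq_zero fun i hi => by
      have hik : k ≠ i := ((Finset.mem_range.1 hi).trans_le h).ne'
      simp [b.ortho, hik]
  simp only [tailProj_apply, map_sub, map_sum, map_smul, hsum, sub_zero]

theorem norm_tailProj_le [CompleteSpace E] (n : ℕ) : ‖tailProj b n‖ ≤ 1 + b.nnnormProjBound :=
  norm_sub_le_of_le ContinuousLinearMap.norm_id_le (b.norm_proj_le_nnnormProjBound _)

theorem comp_tailProj_mem {M : Submodule ℝ (E →L[ℝ] ℝ)} (hM : ∀ n, b.coord n ∈ M)
    {φ : E →L[ℝ] ℝ} (hφ : φ ∈ M) (n : ℕ) : φ.comp (tailProj b n) ∈ M := by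
  have : φ.comp (tailProj b n) = φ - ∑ k ∈ Finset.range n, φ (b k) • b.coord k := by
    ext x
    simp [tailProj_apply, mul_comm]
  exact this ▸ M.sub_mem hφ (M.sum_mem fun k _ => M.smul_mem _ (hM k))

theorem exists_eventually_norm_tailProj_lt [CompleteSpace E] {a : ℝ} (ha : 0 < a) (x : E) :
    ∃ m, ∀ᶠ y in 𝓝 x, ∀ n, m ≤ n → ‖tailProj b n y‖ < a := by
  obtain ⟨m, hm⟩ : ∃ m, ∀ n, m ≤ n → ‖tailProj b n x‖ < a / 2 := by
    have h := (tendsto_tailProj b x).norm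
    rw [norm_zero] at h
    exact eventually_atTop.1 (h.eventually_lt_const (half_pos ha))
  have hnear : ∀ᶠ y in 𝓝 x, (1 + b.nnnormProjBound) * ‖y - x‖ < a / 2 := by
    have h : Continuous fun y => (1 + (b.nnnormProjBound : ℝ)) * ‖y - x‖ := by fun_prop
    exact h.continuousAt.eventually_lt_const (by simpa using ha)
  refine ⟨m, hnear.mono fun y hy n hn => ?_⟩
  calc ‖tailProj b n y‖ = ‖tailProj b n x + tailProj b n (y - x)‖ := by
        rw [← map_add, add_sub_cancel]
    _ ≤ ‖tailProj b n x‖ + ‖tailProj b n (y - x)‖ := norm_add_le _ _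
    _ < a / 2 + a / 2 := add_lt_add (hm n hn)
        (((tailProj b n).le_of_opNorm_le (norm_tailProj_le b n) _).trans_lt hy)
    _ = a := add_halves a

/-- The smoothed truncation operator: the `n`-th coordinate of `x` is multiplied by the value of
`θ` at the `n`-th tail of `x`, so that for a cutoff `θ` it is discarded once the tail is small. -/
noncomputable def damp (θ : E → ℝ) (x : E) : E :=
  ∑' n, θ (tailProj b n x) • b.coord n x • b n

section

variable [CompleteSpace E] {M : Submodule ℝ (E →L[ℝ] ℝ)} {θ : E → ℝ} {a : ℝ}

theorem exists_damp_eventuallyEq (hθ : IsCutoff M θ a) (x : E) :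
    ∃ m, ‖tailProj b m x‖ < a ∧ damp b θ =ᶠ[𝓝 x]
      fun y => ∑ n ∈ Finset.range m, θ (tailProj b n y) • b.coord n y • b n := by
  obtain ⟨m, hm⟩ := exists_eventually_norm_tailProj_lt b hθ.pos x
  refine ⟨m, hm.self_of_nhds m le_rfl, hm.mono fun y hy => tsum_eq_sum fun n hn => ?_⟩
  rw [hθ.eq_zero _ (hy n (by simpa using hn)), zero_smul]

theorem contDiff_damp (hθ : IsCutoff M θ a) : ContDiff ℝ 1 (damp b θ) := by
  refine contDiff_iff_contDiffAt.2 fun x => ?_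
  obtain ⟨m, -, hm⟩ := exists_damp_eventuallyEq b hθ x
  refine ContDiffAt.congr_of_eventuallyEq (ContDiff.contDiffAt ?_) hm
  exact ContDiff.sum fun n _ => (hθ.contDiff.comp (tailProj b n).contDiff).smul
    ((b.coord n).contDiff.smul contDiff_const)

theorem exists_fderiv_damp_eq (hθ : IsCutoff M θ a) (x : E) :
    ∃ m, fderiv ℝ (damp b θ) x = ∑ n ∈ Finset.range m,
      (θ (tailProj b n x) • (b.coord n).smulRight (b n) +
        ((fderiv ℝ θ (tailProj b n x)).comp (tailProj b n)).smulRight (b.coord n x • b n)) := by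
  obtain ⟨m, -, hm⟩ := exists_damp_eventuallyEq b hθ x
  refine ⟨m, (HasFDerivAt.congr_of_eventuallyEq ?_ hm).fderiv⟩
  exact HasFDerivAt.fun_sum fun n _ =>
    ((hθ.hasFDerivAt _).comp x (tailProj b n).hasFDerivAt).smul
      ((b.coord n).hasFDerivAt.smul_const (b n))

theorem fderiv_damp_mem_componentsIn (hθ : IsCutoff M θ a) (hM : ∀ n, b.coord n ∈ M) (x : E) :
    fderiv ℝ (damp b θ) x ∈ componentsIn E M := by
  obtain ⟨m, hm⟩ := exists_fderiv_damp_eq b hθ x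
  rw [hm]
  exact Submodule.sum_mem _ fun n _ => Submodule.add_mem _
    (Submodule.smul_mem _ _ (smulRight_mem_componentsIn (hM n) _))
    (smulRight_mem_componentsIn (comp_tailProj_mem b hM (hθ.fderiv_mem _) n) _)

theorem norm_sum_smul_coord_smul_le_of_eq_zero {s : Finset ℕ} {x : E} {c : ℕ → ℝ} {B : ℝ}
    (hB : 0 ≤ B) (hc : ∀ n, |c n| ≤ B) (hc0 : ∀ n, 1 < ‖tailProj b n x‖ → c n = 0) :
    ‖∑ n ∈ s, c n • b.coord n x • b n‖ ≤ 2 * b.nnnormProjBound * B := by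
  classical
  have hex : ∃ n, ‖tailProj b n x‖ ≤ 1 :=
    (exists_eventually_norm_tailProj_lt b one_pos x).imp fun m hm =>
      (hm.self_of_nhds m le_rfl).le
  -- only indices from the first small tail on contribute, and there `x` agrees with that tail
  let x' := tailProj b (Nat.find hex) x
  have hx' : ∑ n ∈ s, c n • b.coord n x • b n = ∑ n ∈ s, c n • b.coord n x' • b n := by
    refine Finset.sum_congr rfl fun n _ => ?_
    rcases le_or_gt (Nat.find hex) n with hn | hn
    · rw [coord_tailProj b hn]
    · rw [hc0 n (not_le.1 (Nat.find_min hex hn)), zero_smul, zero_smul]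
  rw [hx']
  exact (norm_sum_smul_coord_smul_le b hB (fun n _ => hc n) x').trans
    (mul_le_of_le_one_right (by positivity) (Nat.find_spec hex))

theorem norm_damp_sub_le (hθ : IsCutoff M θ a) (x : E) :
    ‖damp b θ x - x‖ ≤ a + 2 * b.nnnormProjBound := by
  obtain ⟨m, hma, hm⟩ := exists_damp_eventuallyEq b hθ x
  have hsub : x - damp b θ x = tailProj b m x +
      ∑ n ∈ Finset.range m, (1 - θ (tailProj b n x)) • b.coord n x • b n := by
    rw [hm.self_of_nhds, tailProj_apply]
    simp only [sub_smul, one_smul, Finset.sum_sub_distrib]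
    abel
  rw [norm_sub_rev, hsub]
  refine norm_add_le_of_le hma.le ?_
  have h := norm_sum_smul_coord_smul_le_of_eq_zero b (s := Finset.range m)
    (c := fun n => 1 - θ (tailProj b n x)) zero_le_one
    (fun n => abs_le.2 ⟨by linarith [hθ.le_one (tailProj b n x)], by
      linarith [hθ.nonneg (tailProj b n x)]⟩)
    (fun n hn => by rw [hθ.eq_one _ hn.le, sub_self])
  rwa [mul_one] at h

theorem exists_norm_fderiv_damp_le (hθ : IsCutoff M θ a) :
    ∃ C, ∀ x, ‖fderiv ℝ (damp b θ) x‖ ≤ C := by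
  obtain ⟨S, hS⟩ := hθ.exists_norm_fderiv_le
  have hS0 : 0 ≤ S := (norm_nonneg _).trans (hS 0)
  refine ⟨2 * b.nnnormProjBound * 1 + 2 * b.nnnormProjBound * (S * (1 + b.nnnormProjBound)),
    fun x => ContinuousLinearMap.opNorm_le_bound _ (by positivity) fun h => ?_⟩
  obtain ⟨m, hm⟩ := exists_fderiv_damp_eq b hθ x
  let c n := fderiv ℝ θ (tailProj b n x) (tailProj b n h)
  have hsum : fderiv ℝ (damp b θ) x h =
      ∑ n ∈ Finset.range m, θ (tailProj b n x) • b.coord n h • b n +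
        ∑ n ∈ Finset.range m, c n • b.coord n x • b n := by
    rw [hm, ← Finset.sum_add_distrib]
    simp [c]
  have hc n : |c n| ≤ S * (1 + b.nnnormProjBound) * ‖h‖ := by
    have h1 := (tailProj b n).le_of_opNorm_le (norm_tailProj_le b n) h
    exact ((fderiv ℝ θ _).le_of_opNorm_le (hS _) _).trans (by rw [mul_assoc]; gcongr)
  have hc0 n (hn : 1 < ‖tailProj b n x‖) : c n = 0 := by
    simp only [c, hθ.fderiv_eq_zero hn, zero_apply]
  rw [hsum, add_mul]
  refine norm_add_le_of_le (norm_sum_smul_coord_smul_le b zero_le_one (fun n _ => ?_) h)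
    ((norm_sum_smul_coord_smul_le_of_eq_zero b (by positivity) hc hc0).trans_eq (by ring))
  rw [abs_of_nonneg (hθ.nonneg _)]
  exact hθ.le_one _

end

end Damping

section NearIdentity

variable {E F : Type*} [NormedAddCommGroup E] [NormedSpace ℝ E]
  [NormedAddCommGroup F] [NormedSpace ℝ F] {M : Submodule ℝ (E →L[ℝ] ℝ)}

/-- A `C¹` map at uniform distance at most `δ` from the identity, whose derivative is bounded by
`C` and has all its components in the space `M` of functionals.  The bound `C` is a separate
parameter because it has to stay fixed while `δ` tends to `0`. -/
structure IsNearIdentity (M : Submodule ℝ (E →L[ℝ] ℝ)) (C δ : ℝ) (Ψ : E → E) : Prop where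
  contDiff : ContDiff ℝ 1 Ψ
  norm_sub_le : ∀ x, ‖Ψ x - x‖ ≤ δ
  norm_fderiv_le : ∀ x, ‖fderiv ℝ Ψ x‖ ≤ C
  fderiv_mem : ∀ x, fderiv ℝ Ψ x ∈ componentsIn E M

namespace IsNearIdentity

variable {C δ : ℝ} {Ψ : E → E}

protected theorem hasFDerivAt (hΨ : IsNearIdentity M C δ Ψ) (x : E) :
    HasFDerivAt Ψ (fderiv ℝ Ψ x) x :=
  (hΨ.contDiff.differentiable one_ne_zero x).hasFDerivAt

theorem rescale (hΨ : IsNearIdentity M C δ Ψ) {c : ℝ} (hc : 0 < c) :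
    IsNearIdentity M C (c * δ) fun x => c • Ψ (c⁻¹ • x) := by
  have hfderiv x : fderiv ℝ (fun x => c • Ψ (c⁻¹ • x)) x = fderiv ℝ Ψ (c⁻¹ • x) := by
    have h := ((hΨ.hasFDerivAt (c⁻¹ • x)).comp x
      ((hasFDerivAt_id x).const_smul c⁻¹)).const_smul c
    rw [ContinuousLinearMap.comp_smul, smul_inv_smul₀ hc.ne', ContinuousLinearMap.comp_id] at h
    exact h.fderiv
  refine ⟨(hΨ.contDiff.comp (contDiff_id.const_smul c⁻¹)).const_smul c, fun x => ?_,
    fun x => hfderiv x ▸ hΨ.norm_fderiv_le _, fun x => hfderiv x ▸ hΨ.fderiv_mem _⟩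
  calc ‖c • Ψ (c⁻¹ • x) - x‖ = c * ‖Ψ (c⁻¹ • x) - c⁻¹ • x‖ := by
        rw [← Real.norm_of_nonneg hc.le, ← norm_smul, Real.norm_of_nonneg hc.le, smul_sub,
          smul_inv_smul₀ hc.ne']
    _ ≤ c * δ := by
        gcongr
        exact hΨ.norm_sub_le _

theorem mapsTo_ball (hΨ : IsNearIdentity M C δ Ψ) (x : E) (r : ℝ) :
    MapsTo Ψ (Metric.ball x r) (Metric.ball x (r + δ)) := fun y hy => by
  rw [mem_ball_iff_norm] at hy ⊢
  calc ‖Ψ y - x‖ ≤ ‖y - x‖ + ‖Ψ y - y‖ := by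
        rw [add_comm]
        exact norm_sub_le_norm_sub_add_norm_sub (Ψ y) y x
    _ < r + δ := add_lt_add_of_lt_of_le hy (hΨ.norm_sub_le y)

/-- The approximation replaces `f` by `f ∘ Ψ` up to the linear map `A`: since the derivative of
`f - A` is small, composing it with `Ψ` changes it little in the `C¹` sense, even though the
derivative of `Ψ` need not be close to the identity. -/
theorem exists_approx (hΨ : IsNearIdentity M C δ Ψ) {f : E → F} {A : E →L[ℝ] F} {x : E}
    {r η : ℝ} (hf : ContDiffOn ℝ 1 f (Metric.ball x (r + δ)))
    (hA : ∀ y ∈ Metric.ball x (r + δ), ‖fderiv ℝ f y - A‖ ≤ η) :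
    ∃ h : E → F, ContDiffOn ℝ 1 h (Metric.ball x r) ∧ ∀ y ∈ Metric.ball x r,
      ‖h y - f y‖ ≤ η * δ ∧ ‖fderiv ℝ h y - fderiv ℝ f y‖ ≤ η * (C + 1) ∧
      fderiv ℝ h y - A ∈ componentsIn F M := by
  have hδ : 0 ≤ δ := (norm_nonneg _).trans (hΨ.norm_sub_le x)
  have hfd {y} (hy : y ∈ Metric.ball x (r + δ)) : HasFDerivAt f (fderiv ℝ f y) y :=
    ((hf.contDiffAt (Metric.isOpen_ball.mem_nhds hy)).differentiableAt one_ne_zero).hasFDerivAt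
  have hball {y} (hy : y ∈ Metric.ball x r) : y ∈ Metric.ball x (r + δ) :=
    Metric.ball_subset_ball (le_add_of_nonneg_right hδ) hy
  have hmap := hΨ.mapsTo_ball x r
  refine ⟨fun y => f (Ψ y) + A (y - Ψ y),
    (hf.comp hΨ.contDiff.contDiffOn hmap).add
      (A.contDiff.comp (contDiff_id.sub hΨ.contDiff)).contDiffOn, fun y hy => ?_⟩
  have hfderiv : fderiv ℝ (fun y => f (Ψ y) + A (y - Ψ y)) y - A =
      (fderiv ℝ f (Ψ y) - A).comp (fderiv ℝ Ψ y) := by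
    have h := ((hfd (hmap hy)).comp y (hΨ.hasFDerivAt y)).add
      (A.hasFDerivAt.comp y ((hasFDerivAt_id y).sub (hΨ.hasFDerivAt y)))
    rw [ContinuousLinearMap.comp_sub, ContinuousLinearMap.comp_id] at h
    refine (congrArg (· - A) h.fderiv).trans ?_
    rw [ContinuousLinearMap.sub_comp]
    abel
  refine ⟨?_, ?_, hfderiv ▸ comp_mem_componentsIn (hΨ.fderiv_mem y) _⟩
  · have hmean := (convex_ball x (r + δ)).norm_image_sub_le_of_norm_hasFDerivWithin_le
      (f := fun z => f z - A z) (fun z hz => ((hfd hz).sub A.hasFDerivAt).hasFDerivWithinAt) hA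
      (hball hy) (hmap hy)
    calc ‖f (Ψ y) + A (y - Ψ y) - f y‖ = ‖f (Ψ y) - A (Ψ y) - (f y - A y)‖ := by
          rw [map_sub]
          congr 1
          abel
      _ ≤ η * ‖Ψ y - y‖ := hmean
      _ ≤ η * δ := mul_le_mul_of_nonneg_left (hΨ.norm_sub_le y)
          ((norm_nonneg _).trans (hA y (hball hy)))
  · rw [← sub_sub_sub_cancel_right _ _ A, hfderiv, mul_add, mul_one]
    exact norm_sub_le_of_le ((ContinuousLinearMap.opNorm_comp_le _ _).trans
      (mul_le_mul (hA _ (hmap hy)) (hΨ.norm_fderiv_le y) (norm_nonneg _)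
        ((norm_nonneg _).trans (hA y (hball hy))))) (hA y (hball hy))

end IsNearIdentity

theorem exists_isNearIdentity [CompleteSpace E] (b : UnconditionalSchauderBasis ℕ ℝ E) {θ : E → ℝ}
    {a : ℝ} (hθ : IsCutoff M θ a) (hM : ∀ n, b.coord n ∈ M) :
    ∃ C, ∀ δ > 0, ∃ Ψ, IsNearIdentity M C δ Ψ := by
  obtain ⟨C, hC⟩ := exists_norm_fderiv_damp_le b hθ
  have hdamp : IsNearIdentity M C (a + 2 * b.nnnormProjBound) (damp b θ) :=
    ⟨contDiff_damp b hθ, norm_damp_sub_le b hθ, hC, fderiv_damp_mem_componentsIn b hθ hM⟩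
  have hpos : 0 < a + 2 * b.nnnormProjBound := add_pos_of_pos_of_nonneg hθ.pos (by positivity)
  refine ⟨C, fun δ hδ => ?_⟩
  have h := hdamp.rescale (div_pos hδ hpos)
  rw [div_mul_cancel₀ _ hpos.ne'] at h
  exact ⟨_, h⟩

end NearIdentity

section Partition

variable {E F : Type*} [NormedAddCommGroup E] [NormedSpace ℝ E]
  [NormedAddCommGroup F] [NormedSpace ℝ F] {M : Submodule ℝ (E →L[ℝ] ℝ)}

/-- A partition of unity on `U` made of `C¹` weights with differentials in `M`, the `n`-th one
supported in `V n`.  Local finiteness is encoded by asking that near each point of `U` only an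
initial segment of the sequence is nonzero. -/
structure IsC1Partition (M : Submodule ℝ (E →L[ℝ] ℝ)) (U : Set E) (V : ℕ → Set E)
    (φ : ℕ → E → ℝ) : Prop where
  isC1Weight : ∀ n, IsC1Weight M (φ n)
  tsupport_subset : ∀ n, tsupport (φ n) ⊆ V n
  exists_sum_eq_one : ∀ y ∈ U, ∃ m, ∀ᶠ z in 𝓝 y,
    (∀ n, m ≤ n → φ n z = 0) ∧ ∑ n ∈ Finset.range m, φ n z = 1

theorem IsCutoff.tsupport_one_sub_comp_subset {θ : E → ℝ} {a : ℝ} (hθ : IsCutoff M θ a) {r : ℝ}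
    (hr : 0 < r) (p : E) :
    tsupport (fun y => 1 - θ ((2 / r) • (y - p))) ⊆ Metric.ball p r := by
  refine (closure_minimal (fun y hy => ?_) Metric.isClosed_closedBall).trans
    (Metric.closedBall_subset_ball (half_lt_self hr))
  by_contra hyp
  rw [mem_closedBall_iff_norm, not_le] at hyp
  refine hy (sub_eq_zero.2 (hθ.eq_one _ ?_).symm)
  rw [norm_smul, Real.norm_of_nonneg (by positivity)]
  calc 1 = 2 / r * (r / 2) := by field_simp
    _ ≤ 2 / r * ‖y - p‖ := by gcongr

theorem IsCutoff.comp_smul_sub_eq_zero {θ : E → ℝ} {a : ℝ} (hθ : IsCutoff M θ a) {r : ℝ}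
    (hr : 0 < r) {p z : E} (hz : z ∈ Metric.ball p (a * r / 2)) : θ ((2 / r) • (z - p)) = 0 := by
  refine hθ.eq_zero _ ?_
  rw [norm_smul, Real.norm_of_nonneg (by positivity)]
  calc 2 / r * ‖z - p‖ < 2 / r * (a * r / 2) := by
        gcongr
        exact mem_ball_iff_norm.1 hz
    _ = a := by field_simp

theorem IsCutoff.exists_isC1Partition [SecondCountableTopology E] {θ : E → ℝ} {a : ℝ}
    (hθ : IsCutoff M θ a) {U : Set E} (hU : U.Nonempty) (r : E → ℝ) (hr : ∀ x ∈ U, 0 < r x) :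
    ∃ (x : ℕ → E) (φ : ℕ → E → ℝ), (∀ n, x n ∈ U) ∧
      IsC1Partition M U (fun n => Metric.ball (x n) (r (x n))) φ := by
  obtain ⟨t, htU, htc, hcov⟩ := TopologicalSpace.countable_cover_nhdsWithin (s := U)
    (f := fun x => Metric.ball x (a * r x / 2)) fun x hx => mem_nhdsWithin_of_mem_nhds
      (Metric.ball_mem_nhds x (half_pos (mul_pos hθ.pos (hr x hx))))
  have ht : t.Nonempty := by
    obtain ⟨x, hx, -⟩ := mem_iUnion₂.1 (hcov hU.some_mem)
    exact ⟨x, hx⟩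
  obtain ⟨x, rfl⟩ := htc.exists_eq_range ht
  have hxU n : x n ∈ U := htU (mem_range_self n)
  let τ : ℕ → E → ℝ := fun n y => θ ((2 / r (x n)) • (y - x n))
  have hτ n : IsC1Weight M (τ n) := hθ.comp_smul_sub _ _
  refine ⟨x, fun n y => (∏ j ∈ Finset.range n, τ j y) * (1 - τ n y), hxU,
    fun n => (IsC1Weight.prod hτ n).mul (hτ n).one_sub,
    fun n => (closure_mono (Function.support_mul_subset_right _ _)).trans
      (hθ.tsupport_one_sub_comp_subset (hr _ (hxU n)) _), fun y hy => ?_⟩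
  obtain ⟨_, ⟨k, rfl⟩, hk⟩ := mem_iUnion₂.1 (hcov hy)
  refine ⟨k + 1, (Metric.isOpen_ball.eventually_mem hk).mono fun z hz => ?_⟩
  have hprod {n : ℕ} (hn : k + 1 ≤ n) : ∏ j ∈ Finset.range n, τ j z = 0 :=
    Finset.prod_eq_zero (Finset.mem_range.2 hn) (hθ.comp_smul_sub_eq_zero (hr _ (hxU k)) hz)
  refine ⟨fun n hn => mul_eq_zero_of_left (hprod hn) _, ?_⟩
  calc ∑ n ∈ Finset.range (k + 1), (∏ j ∈ Finset.range n, τ j z) * (1 - τ n z)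
      = ∑ n ∈ Finset.range (k + 1),
          (∏ j ∈ Finset.range n, τ j z - ∏ j ∈ Finset.range (n + 1), τ j z) := by
        simp only [Finset.prod_range_succ, mul_one_sub]
    _ = 1 := by rw [Finset.sum_range_sub', hprod le_rfl, Finset.prod_range_zero, sub_zero]

theorem exists_pos_forall_sum_norm_fderiv_mul_le {φ : ℕ → E → ℝ}
    (hφ : ∀ n, IsC1Weight M (φ n)) {e : ℝ} (he : 0 < e) :
    ∃ κ : ℕ → ℝ, (∀ n, 0 < κ n ∧ κ n ≤ e) ∧
      ∀ y (t : Finset ℕ), ∑ n ∈ t, ‖fderiv ℝ (φ n) y‖ * κ n ≤ e := by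
  choose K hK using fun n => (hφ n).exists_norm_fderiv_le
  have hK₀ n : 0 ≤ K n := (norm_nonneg _).trans (hK n 0)
  obtain ⟨e', he', hsum⟩ := (countable_univ (α := ℕ)).exists_pos_forall_sum_le he
  refine ⟨fun n => e' n / (1 + K n), fun n => ⟨div_pos (he' n) (by linarith [hK₀ n]), ?_⟩,
    fun y t => (Finset.sum_le_sum fun n _ => ?_).trans (hsum t (subset_univ _))⟩
  · calc e' n / (1 + K n) ≤ e' n := div_le_self (he' n).le (by linarith [hK₀ n])
      _ ≤ e := by simpa using hsum {n} (subset_univ _)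
  · have hpos : 0 < 1 + K n := by linarith [hK₀ n]
    rw [mul_div_assoc', div_le_iff₀ hpos, mul_comm]
    exact mul_le_mul_of_nonneg_left (by linarith [hK n y]) (he' n).le

/-- The map `∑ₙ φₙ • kₙ` glued from local maps `kₙ` by means of a partition of unity. -/
noncomputable def glue (φ : ℕ → E → ℝ) (k : ℕ → E → F) (y : E) : F :=
  ∑' n, φ n y • k n y

namespace IsC1Partition

variable {U : Set E} {V : ℕ → Set E} {φ : ℕ → E → ℝ} {k : ℕ → E → F} {y : E} {m : ℕ}

theorem eventuallyEq_zero (hφ : IsC1Partition M U V φ) {n : ℕ} (hy : y ∉ V n) :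
    φ n =ᶠ[𝓝 y] fun _ => 0 :=
  notMem_tsupport_iff_eventuallyEq.1 fun h => hy (hφ.tsupport_subset n h)

theorem sum_smul_mem (hφ : IsC1Partition M U V φ) {G : Type*} [AddCommGroup G] [Module ℝ G]
    {S : Set G} (hS : Convex ℝ S) (hm : ∑ n ∈ Finset.range m, φ n y = 1) {v : ℕ → G}
    (hv : ∀ n, y ∈ V n → v n ∈ S) : ∑ n ∈ Finset.range m, φ n y • v n ∈ S := by
  classical
  have hmem n (hn : φ n y ≠ 0) : y ∈ V n :=
    hφ.tsupport_subset n (subset_tsupport _ hn)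
  rw [← Finset.sum_filter_of_ne (p := fun n => y ∈ V n) fun n _ h => hmem n h] at hm
  rw [← Finset.sum_filter_of_ne (p := fun n => y ∈ V n) fun n _ h =>
    hmem n (left_ne_zero_of_smul h)]
  exact hS.sum_mem (fun n _ => (hφ.isC1Weight n).nonneg y) hm
    fun n hn => hv n (Finset.mem_filter.1 hn).2

theorem contDiffAt_smul (hφ : IsC1Partition M U V φ) (hV : ∀ n, IsOpen (V n))
    (hk : ∀ n, ContDiffOn ℝ 1 (k n) (V n)) (n : ℕ) (y : E) :
    ContDiffAt ℝ 1 (fun z => φ n z • k n z) y := by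
  by_cases hy : y ∈ V n
  · exact (hφ.isC1Weight n).contDiff.contDiffAt.smul ((hk n).contDiffAt ((hV n).mem_nhds hy))
  · exact contDiffAt_const.congr_of_eventuallyEq ((hφ.eventuallyEq_zero hy).mono fun z hz =>
      smul_eq_zero_of_left hz (k n z))

theorem hasFDerivAt_smul (hφ : IsC1Partition M U V φ) (hV : ∀ n, IsOpen (V n))
    (hk : ∀ n, ContDiffOn ℝ 1 (k n) (V n)) (n : ℕ) (y : E) :
    HasFDerivAt (fun z => φ n z • k n z)
      (φ n y • fderiv ℝ (k n) y + (fderiv ℝ (φ n) y).smulRight (k n y)) y := by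
  by_cases hy : y ∈ V n
  · exact ((hφ.isC1Weight n).hasFDerivAt y).smul
      (((hk n).contDiffAt ((hV n).mem_nhds hy)).differentiableAt one_ne_zero).hasFDerivAt
  · have h := hφ.eventuallyEq_zero hy
    have hzero : (fun z => φ n z • k n z) =ᶠ[𝓝 y] fun _ => 0 :=
      h.mono fun z hz => smul_eq_zero_of_left hz (k n z)
    rw [h.fderiv_eq, h.self_of_nhds, fderiv_fun_const]
    simpa using (hasFDerivAt_const (𝕜 := ℝ) (0 : F) y).congr_of_eventuallyEq hzero

theorem exists_glue_eventuallyEq_sum (hφ : IsC1Partition M U V φ) (k : ℕ → E → F) (hy : y ∈ U) :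
    ∃ m, (∀ᶠ z in 𝓝 y, ∑ n ∈ Finset.range m, φ n z = 1) ∧
      glue φ k =ᶠ[𝓝 y] fun z => ∑ n ∈ Finset.range m, φ n z • k n z := by
  obtain ⟨m, hm⟩ := hφ.exists_sum_eq_one y hy
  refine ⟨m, hm.mono fun z hz => hz.2, hm.mono fun z hz => tsum_eq_sum fun n hn => ?_⟩
  rw [hz.1 n (by simpa using hn), zero_smul]

theorem contDiffOn_glue (hφ : IsC1Partition M U V φ) (hV : ∀ n, IsOpen (V n))
    (hk : ∀ n, ContDiffOn ℝ 1 (k n) (V n)) : ContDiffOn ℝ 1 (glue φ k) U := fun y hy => by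
  obtain ⟨m, -, hm⟩ := hφ.exists_glue_eventuallyEq_sum k hy
  exact ((ContDiffAt.sum fun n _ =>
    hφ.contDiffAt_smul hV hk n y).congr_of_eventuallyEq hm).contDiffWithinAt

/-- Because the differentials of the weights add up to zero, the values `kₙ y` may be measured
from an arbitrary vector `v` in the derivative of the glued map. -/
theorem exists_hasFDerivAt_glue (hφ : IsC1Partition M U V φ) (hV : ∀ n, IsOpen (V n))
    (hk : ∀ n, ContDiffOn ℝ 1 (k n) (V n)) (hy : y ∈ U) :
    ∃ m, ∑ n ∈ Finset.range m, φ n y = 1 ∧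
      ∀ v, HasFDerivAt (glue φ k) (∑ n ∈ Finset.range m, φ n y • fderiv ℝ (k n) y +
        ∑ n ∈ Finset.range m, (fderiv ℝ (φ n) y).smulRight (k n y - v)) y := by
  obtain ⟨m, hsum, hm⟩ := hφ.exists_glue_eventuallyEq_sum k hy
  have hfderiv_sum : ∑ n ∈ Finset.range m, fderiv ℝ (φ n) y = 0 := by
    rw [← fderiv_fun_sum fun n _ => ((hφ.isC1Weight n).hasFDerivAt y).differentiableAt,
      EventuallyEq.fderiv_eq (f := fun _ => (1 : ℝ)) hsum, fderiv_fun_const, Pi.zero_apply]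
  refine ⟨m, hsum.self_of_nhds, fun v => ?_⟩
  have hv : ∑ n ∈ Finset.range m, (fderiv ℝ (φ n) y).smulRight (k n y - v) =
      ∑ n ∈ Finset.range m, (fderiv ℝ (φ n) y).smulRight (k n y) := by
    ext u
    have hu := congrArg (fun L : E →L[ℝ] ℝ => L u • v) hfderiv_sum
    simp only [_root_.sum_apply, Finset.sum_smul, _root_.zero_apply, zero_smul] at hu
    simp only [_root_.sum_apply, ContinuousLinearMap.smulRight_apply, smul_sub,
      Finset.sum_sub_distrib, hu, sub_zero]
  rw [hv, ← Finset.sum_add_distrib]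
  exact (HasFDerivAt.fun_sum fun n _ => hφ.hasFDerivAt_smul hV hk n y).congr_of_eventuallyEq hm

end IsC1Partition

end Partition

section LocallyPosOn

variable {X : Type*} [TopologicalSpace X] {U : Set X} {ε : X → ℝ}

/-- Near each point of `U` the function `ε` has a positive lower bound.  Local approximations only
see such a bound, so this replaces continuity of the tolerance. -/
def LocallyPosOn (ε : X → ℝ) (U : Set X) : Prop :=
  ∀ x ∈ U, ∃ c > 0, ∀ᶠ y in 𝓝 x, c ≤ ε y

theorem locallyPosOn_of_continuousOn (hU : IsOpen U) (hε : ContinuousOn ε U)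
    (hpos : ∀ x ∈ U, 0 < ε x) : LocallyPosOn ε U := fun x hx =>
  ⟨ε x / 2, half_pos (hpos x hx), ((hε.continuousAt (hU.mem_nhds hx)).eventually
    (lt_mem_nhds (half_lt_self (hpos x hx)))).mono fun _ hy => hy.le⟩

namespace LocallyPosOn

theorem pos (hε : LocallyPosOn ε U) {x : X} (hx : x ∈ U) : 0 < ε x := by
  obtain ⟨c, hc, h⟩ := hε x hx
  exact hc.trans_le h.self_of_nhds

theorem div (hε : LocallyPosOn ε U) {w : X → ℝ} (hw : Continuous w) (hpos : ∀ x, 0 < w x) :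
    LocallyPosOn (fun x => ε x / w x) U := fun x hx => by
  obtain ⟨c, hc, h⟩ := hε x hx
  refine ⟨c / (w x + 1), div_pos hc (by linarith [hpos x]), ?_⟩
  filter_upwards [h, hw.continuousAt.eventually (gt_mem_nhds (lt_add_one (w x)))] with y hy hwy
  exact div_le_div₀ (hc.le.trans hy) hy (hpos y) hwy.le

end LocallyPosOn

end LocallyPosOn

section Approximation

variable {E F : Type*} [NormedAddCommGroup E] [NormedSpace ℝ E]
  [NormedAddCommGroup F] [NormedSpace ℝ F] {M : Submodule ℝ (E →L[ℝ] ℝ)} {U : Set E} {ε : E → ℝ}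

namespace IsC1Partition

variable {V : ℕ → Set E} {φ : ℕ → E → ℝ} {k : ℕ → E → F} {y : E}

theorem glue_mem (hφ : IsC1Partition M U V φ) {S : Set F} (hS : Convex ℝ S) (hy : y ∈ U)
    (hkS : ∀ n, y ∈ V n → k n y ∈ S) : glue φ k y ∈ S := by
  obtain ⟨m, hsum, hm⟩ := hφ.exists_glue_eventuallyEq_sum k hy
  rw [hm.self_of_nhds]
  exact hφ.sum_smul_mem hS hsum.self_of_nhds hkS

theorem fderiv_glue_mem (hφ : IsC1Partition M U V φ) (hV : ∀ n, IsOpen (V n))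
    (hk : ∀ n, ContDiffOn ℝ 1 (k n) (V n)) {W : Submodule ℝ (E →L[ℝ] F)}
    (hW : componentsIn F M ≤ W) (hy : y ∈ U) (hkW : ∀ n, y ∈ V n → fderiv ℝ (k n) y ∈ W) :
    fderiv ℝ (glue φ k) y ∈ W := by
  obtain ⟨m, hsum, hm⟩ := hφ.exists_hasFDerivAt_glue hV hk hy
  rw [(hm 0).fderiv]
  exact W.add_mem (hφ.sum_smul_mem W.convex hsum hkW) (Submodule.sum_mem _ fun n _ =>
    hW (smulRight_mem_componentsIn ((hφ.isC1Weight n).fderiv_mem y) _))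

theorem norm_fderiv_glue_sub_le (hφ : IsC1Partition M U V φ) (hV : ∀ n, IsOpen (V n))
    (hk : ∀ n, ContDiffOn ℝ 1 (k n) (V n)) (hy : y ∈ U) {κ : ℕ → ℝ} {c e : ℝ}
    (hκ : ∀ t : Finset ℕ, ∑ n ∈ t, ‖fderiv ℝ (φ n) y‖ * κ n ≤ c)
    (he : 0 ≤ e) {v : F} {A : E →L[ℝ] F} (hkv : ∀ n, y ∈ V n → ‖k n y - v‖ ≤ κ n * e)
    (hkA : ∀ n, y ∈ V n → ‖fderiv ℝ (k n) y - A‖ ≤ c * e) :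
    ‖fderiv ℝ (glue φ k) y - A‖ ≤ 2 * c * e := by
  obtain ⟨m, hsum, hm⟩ := hφ.exists_hasFDerivAt_glue hV hk hy
  have hconv : ‖∑ n ∈ Finset.range m, φ n y • fderiv ℝ (k n) y - A‖ ≤ c * e :=
    mem_closedBall_iff_norm.1 (hφ.sum_smul_mem (convex_closedBall A (c * e)) hsum
      fun n hn => mem_closedBall_iff_norm.2 (hkA n hn))
  have hcorrection : ‖∑ n ∈ Finset.range m, (fderiv ℝ (φ n) y).smulRight (k n y - v)‖ ≤ c * e := by
    calc _ ≤ ∑ n ∈ Finset.range m, ‖fderiv ℝ (φ n) y‖ * κ n * e := by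
          refine norm_sum_le_of_le _ fun n _ => ?_
          rw [ContinuousLinearMap.norm_smulRight_apply, mul_assoc]
          by_cases hn : y ∈ V n
          · exact mul_le_mul_of_nonneg_left (hkv n hn) (norm_nonneg _)
          · rw [(hφ.eventuallyEq_zero hn).fderiv_eq, fderiv_fun_const, Pi.zero_apply, norm_zero,
              zero_mul, zero_mul]
      _ ≤ c * e := by
          rw [← Finset.sum_mul]
          exact mul_le_mul_of_nonneg_right (hκ _) he
  rw [(hm v).fderiv, add_sub_right_comm, two_mul, add_mul]
  exact norm_add_le_of_le hconv hcorrection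

end IsC1Partition

theorem exists_approx_of_forall_exists_approx_on_ball [SecondCountableTopology E] {θ : E → ℝ}
    {a : ℝ} (hθ : IsCutoff M θ a) (hU : U.Nonempty) (hε : ∀ y ∈ U, 0 ≤ ε y) {f : E → F}
    {A : E → E →L[ℝ] F} {S : Set F} (hS : Convex ℝ S)
    (hloc : ∀ x ∈ U, ∃ r > 0, ∀ κ > 0, ∃ h : E → F, ContDiffOn ℝ 1 h (Metric.ball x r) ∧
      ∀ y ∈ Metric.ball x r, h y ∈ S ∧ ‖h y - f y‖ ≤ κ * ε y ∧
        ‖fderiv ℝ h y - fderiv ℝ f y‖ ≤ 1 / 2 * ε y ∧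
        fderiv ℝ h y - A x ∈ componentsIn F M) :
    ∃ (x : ℕ → E) (g : E → F), ContDiffOn ℝ 1 g U ∧ ∀ y ∈ U, g y ∈ S ∧ ‖g y - f y‖ ≤ ε y ∧
      ‖fderiv ℝ g y - fderiv ℝ f y‖ ≤ ε y ∧
      fderiv ℝ g y ∈ componentsIn F M ⊔ Submodule.span ℝ (range (A ∘ x)) := by
  choose! r hr hr' using hloc
  obtain ⟨x, φ, hx, hφ⟩ := hθ.exists_isC1Partition hU r hr
  obtain ⟨κ, hκ, hκφ⟩ := exists_pos_forall_sum_norm_fderiv_mul_le hφ.isC1Weight one_half_pos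
  choose k hk hkx using fun n => hr' (x n) (hx n) (κ n) (hκ n).1
  have hV n : IsOpen (Metric.ball (x n) (r (x n))) := Metric.isOpen_ball
  refine ⟨x, glue φ k, hφ.contDiffOn_glue hV hk, fun y hy => ⟨?_, ?_, ?_, ?_⟩⟩
  · exact hφ.glue_mem hS hy fun n hn => (hkx n y hn).1
  · refine mem_closedBall_iff_norm.1 (hφ.glue_mem (convex_closedBall _ _) hy fun n hn => ?_)
    refine mem_closedBall_iff_norm.2 ((hkx n y hn).2.1.trans ?_)
    exact mul_le_of_le_one_left (hε y hy) ((hκ n).2.trans one_half_lt_one.le)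
  · simpa using hφ.norm_fderiv_glue_sub_le hV hk hy (hκφ y) (hε y hy) (fun n hn => (hkx n y hn).2.1)
      fun n hn => (hkx n y hn).2.2.1
  · refine hφ.fderiv_glue_mem hV hk le_sup_left hy fun n hn => ?_
    rw [← sub_add_cancel (fderiv ℝ (k n) y) (A (x n))]
    exact Submodule.add_mem_sup (hkx n y hn).2.2.2 (Submodule.subset_span ⟨n, rfl⟩)

theorem exists_approx_on_ball {C : ℝ} (hM : ∀ δ > 0, ∃ Ψ, IsNearIdentity M C δ Ψ)
    (hU : IsOpen U) {f : E → F} (hf : ContDiffOn ℝ 1 f U) (hε : LocallyPosOn ε U) {x : E}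
    (hx : x ∈ U) :
    ∃ r > 0, ∀ κ > 0, ∃ h : E → F, ContDiffOn ℝ 1 h (Metric.ball x r) ∧
      ∀ y ∈ Metric.ball x r, ‖h y - f y‖ ≤ κ * ε y ∧
        ‖fderiv ℝ h y - fderiv ℝ f y‖ ≤ 1 / 2 * ε y ∧
        fderiv ℝ h y - fderiv ℝ f x ∈ componentsIn F M := by
  have hC : 0 ≤ C := by
    obtain ⟨Ψ, hΨ⟩ := hM 1 one_pos
    exact (norm_nonneg _).trans (hΨ.norm_fderiv_le x)
  obtain ⟨c, hc, hcε⟩ := hε x hx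
  obtain ⟨η, hη, hηc⟩ : ∃ η > 0, η * (C + 1) = 1 / 2 * c :=
    ⟨1 / 2 * c / (C + 1), by positivity, div_mul_cancel₀ _ (by positivity)⟩
  have hderiv : ∀ᶠ y in 𝓝 x, fderiv ℝ f y ∈ Metric.ball (fderiv ℝ f x) η :=
    ((hf.continuousOn_fderiv_of_isOpen hU le_rfl).continuousAt (hU.mem_nhds hx)).eventually
      (Metric.ball_mem_nhds _ hη)
  obtain ⟨R, hR, hball⟩ :=
    Metric.eventually_nhds_iff_ball.1 ((hcε.and hderiv).and (hU.eventually_mem hx))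
  refine ⟨R / 2, half_pos hR, fun κ hκ => ?_⟩
  obtain ⟨δ, hδ, hδR, hδκ⟩ : ∃ δ > 0, δ ≤ R / 2 ∧ η * δ ≤ κ * c :=
    ⟨min (R / 2) (κ * c / η), by positivity, min_le_left _ _,
      (le_div_iff₀' hη).1 (min_le_right _ _)⟩
  have hsub : Metric.ball x (R / 2 + δ) ⊆ Metric.ball x R :=
    Metric.ball_subset_ball (by linarith)
  obtain ⟨Ψ, hΨ⟩ := hM δ hδ
  obtain ⟨h, hh, hhx⟩ := hΨ.exists_approx (hf.mono fun y hy => (hball y (hsub hy)).2)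
    fun y hy => (mem_ball_iff_norm.1 (hball y (hsub hy)).1.2).le
  refine ⟨h, hh, fun y hy => ?_⟩
  have hcy : c ≤ ε y := (hball y (Metric.ball_subset_ball (half_le_self hR.le) hy)).1.1
  obtain ⟨hval, hder, hmem⟩ := hhx y hy
  refine ⟨hval.trans (hδκ.trans ?_), hder.trans (hηc.trans_le ?_), hmem⟩ <;> gcongr

theorem exists_approx_fderiv_mem [SecondCountableTopology E] {θ : E → ℝ} {a C : ℝ}
    (hθ : IsCutoff M θ a) (hM : ∀ δ > 0, ∃ Ψ, IsNearIdentity M C δ Ψ) (hU : IsOpen U)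
    (hne : U.Nonempty) {f : E → F} (hf : ContDiffOn ℝ 1 f U) (hε : LocallyPosOn ε U) :
    ∃ (x : ℕ → E) (g : E → F), ContDiffOn ℝ 1 g U ∧ ∀ y ∈ U, ‖g y - f y‖ ≤ ε y ∧
      ‖fderiv ℝ g y - fderiv ℝ f y‖ ≤ ε y ∧
      fderiv ℝ g y ∈ componentsIn F M ⊔ Submodule.span ℝ (range (fderiv ℝ f ∘ x)) := by
  obtain ⟨x, g, hg, hgU⟩ := exists_approx_of_forall_exists_approx_on_ball (f := f)
    (A := fderiv ℝ f) hθ hne (fun y hy => (hε.pos hy).le) convex_univ fun x hx => by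
      simpa using exists_approx_on_ball hM hU hf hε hx
  exact ⟨x, g, hg, fun y hy => (hgU y hy).2⟩

theorem exists_pos_le_norm_fderiv_le [SecondCountableTopology E] {θ : E → ℝ} {a : ℝ}
    (hθ : IsCutoff M θ a) (hne : U.Nonempty) (hε : LocallyPosOn ε U) :
    ∃ ρ : E → ℝ, ContDiffOn ℝ 1 ρ U ∧ ∀ y ∈ U, 0 < ρ y ∧ ρ y ≤ ε y ∧ ‖fderiv ℝ ρ y‖ ≤ ε y ∧
      fderiv ℝ ρ y ∈ M := by
  obtain ⟨x, ρ, hρ, hρU⟩ := exists_approx_of_forall_exists_approx_on_ball (f := fun _ => 0)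
    (A := fun _ => 0) hθ hne (fun y hy => (hε.pos hy).le) (convex_Ioi (0 : ℝ)) fun x hx => by
      obtain ⟨c, hc, hcε⟩ := hε x hx
      obtain ⟨r, hr, hball⟩ := Metric.eventually_nhds_iff_ball.1 hcε
      refine ⟨r, hr, fun κ hκ => ⟨fun _ => κ * c, contDiffOn_const, fun y hy => ?_⟩⟩
      have hcy := hball y hy
      refine ⟨mul_pos hκ hc, ?_, ?_, ?_⟩
      · rw [sub_zero, Real.norm_of_nonneg (by positivity)]
        exact mul_le_mul_of_nonneg_left hcy hκ.le
      · rw [fderiv_fun_const, fderiv_fun_const, sub_self, norm_zero]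
        linarith
      · rw [fderiv_fun_const, Pi.zero_apply, sub_zero]
        exact zero_mem _
  refine ⟨ρ, hρ, fun y hy => ?_⟩
  obtain ⟨hpos, hval, hder, hmem⟩ := hρU y hy
  rw [sub_zero, Real.norm_of_nonneg hpos.le] at hval
  rw [fderiv_fun_const, Pi.zero_apply, sub_zero] at hder
  refine ⟨hpos, hval, hder, ?_⟩
  have hspan : Submodule.span ℝ (range ((fun _ => 0 : E → E →L[ℝ] ℝ) ∘ x)) = ⊥ :=
    Submodule.span_eq_bot.2 (by rintro _ ⟨n, rfl⟩; rfl)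
  rw [hspan, sup_bot_eq] at hmem
  exact hmem (ContinuousLinearMap.id ℝ ℝ)

theorem exists_smul_norm_le [SecondCountableTopology E] {θ : E → ℝ} {a : ℝ}
    (hθ : IsCutoff M θ a) (hU : IsOpen U) (hne : U.Nonempty) (hε : LocallyPosOn ε U)
    (T : E →L[ℝ] F) :
    ∃ ρ : E → ℝ, ContDiffOn ℝ 1 ρ U ∧ ∀ y ∈ U, ρ y ≠ 0 ∧ ‖ρ y • T y‖ ≤ ε y ∧
      ‖fderiv ℝ (fun z => ρ z • T z) y‖ ≤ ε y ∧
      fderiv ℝ (fun z => ρ z • T z) y - ρ y • T ∈ componentsIn F M := by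
  have hpos y : 0 < ‖T‖ + ‖T y‖ + 1 := by positivity
  obtain ⟨ρ, hρ, hρU⟩ := exists_pos_le_norm_fderiv_le hθ hne
    (hε.div (w := fun y : E => ‖T‖ + ‖T y‖ + 1) (by fun_prop) hpos)
  refine ⟨ρ, hρ, fun y hy => ?_⟩
  obtain ⟨hρ₀, hval, hder, hmem⟩ := hρU y hy
  have hfderiv : fderiv ℝ (fun z => ρ z • T z) y = ρ y • T + (fderiv ℝ ρ y).smulRight (T y) :=
    (((hρ.contDiffAt (hU.mem_nhds hy)).differentiableAt one_ne_zero).hasFDerivAt.smul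
      T.hasFDerivAt).fderiv
  have hmul : ε y / (‖T‖ + ‖T y‖ + 1) * (‖T‖ + ‖T y‖ + 1) = ε y := div_mul_cancel₀ _ (hpos y).ne'
  set e := ε y / (‖T‖ + ‖T y‖ + 1)
  have he : 0 ≤ e := hρ₀.le.trans hval
  refine ⟨hρ₀.ne', ?_, ?_, ?_⟩
  · calc ‖ρ y • T y‖ = ρ y * ‖T y‖ := by rw [norm_smul, Real.norm_of_nonneg hρ₀.le]
      _ ≤ e * (‖T‖ + ‖T y‖ + 1) := by
          gcongr
          linarith [norm_nonneg T]
      _ = ε y := hmul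
  · calc ‖fderiv ℝ (fun z => ρ z • T z) y‖ ≤ ‖ρ y • T‖ + ‖(fderiv ℝ ρ y).smulRight (T y)‖ :=
          hfderiv ▸ norm_add_le _ _
      _ = ρ y * ‖T‖ + ‖fderiv ℝ ρ y‖ * ‖T y‖ := by
          rw [norm_smul, Real.norm_of_nonneg hρ₀.le, ContinuousLinearMap.norm_smulRight_apply]
      _ ≤ e * ‖T‖ + e * ‖T y‖ := by gcongr
      _ ≤ e * (‖T‖ + ‖T y‖ + 1) := by linarith
      _ = ε y := hmul
  · rw [hfderiv, add_sub_cancel_left]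
    exact smulRight_mem_componentsIn hmem _

end Approximation

section Main

variable {E : Type*} [NormedAddCommGroup E] [NormedSpace ℝ E]

theorem secondCountableTopology_of_unconditionalSchauderBasis
    (b : UnconditionalSchauderBasis ℕ ℝ E) : SecondCountableTopology E := by
  have hdense : closure (Submodule.span ℝ (range b.basis) : Set E) = univ :=
    eq_univ_of_forall fun x => mem_closure_of_tendsto (b.expansion x).tendsto_sum_nat
      (.of_forall fun n => Submodule.sum_mem _ fun i _ =>
        Submodule.smul_mem _ _ (Submodule.subset_span (mem_range_self i)))
  have hsep : TopologicalSpace.IsSeparable (closure (Submodule.span ℝ (range b.basis) : Set E)) :=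
    (countable_range b.basis).isSeparable.span.closure
  rw [hdense, TopologicalSpace.isSeparable_univ_iff] at hsep
  exact UniformSpace.secondCountable_of_separable E

theorem not_finiteDimensional_of_unconditionalSchauderBasis
    (b : UnconditionalSchauderBasis ℕ ℝ E) : ¬ FiniteDimensional ℝ E := fun _ =>
  not_finite_iff_infinite.2 inferInstance b.linearIndependent.finite

theorem exists_isCutoff_isNearIdentity [CompleteSpace E] (b : UnconditionalSchauderBasis ℕ ℝ E)
    [SecondCountableTopology E] {N : Seminorm ℝ E} (hN : IsEquivalentNorm N) (hN₁ : IsC1Norm N)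
    (hNL : LocallyDependsOnFinitelyManyCoordinates N) :
    ∃ s : Set (E →L[ℝ] ℝ), s.Countable ∧ (∃ θ a, IsCutoff (Submodule.span ℝ s) θ a) ∧
      ∃ C, ∀ δ > 0, ∃ Ψ, IsNearIdentity (Submodule.span ℝ s) C δ Ψ := by
  obtain ⟨s, hs, hsN⟩ := hNL.exists_countable_fderiv_mem_span hN₁
  obtain ⟨θ, a, hθ⟩ := exists_isCutoff hN hN₁ (M := Submodule.span ℝ (s ∪ range b.coord))
    fun z hz => Submodule.span_mono subset_union_left (hsN z hz)
  exact ⟨s ∪ range b.coord, hs.union (countable_range _), ⟨θ, a, hθ⟩, exists_isNearIdentity b hθ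
    fun n => Submodule.subset_span (.inr (mem_range_self n))⟩

theorem theorem3p1_general [CompleteSpace E] {F : Type*} [NormedAddCommGroup F] [NormedSpace ℝ F]
    [FiniteDimensional ℝ F] (hbasis : Nonempty (UnconditionalSchauderBasis ℕ ℝ E))
    (hnorm : ∃ N : Seminorm ℝ E,
      IsEquivalentNorm N ∧ IsC1Norm N ∧ LocallyDependsOnFinitelyManyCoordinates N)
    {U : Set E} (hU : IsOpen U) {f : E → F} (hf : ContDiffOn ℝ 1 f U)
    {ε : E → ℝ} (hε : LocallyPosOn ε U) :
    ∃ g : E → F, ContDiffOn ℝ 1 g U ∧ (∀ x ∈ U, ‖f x - g x‖ ≤ ε x) ∧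
      (∀ x ∈ U, ‖fderiv ℝ f x - fderiv ℝ g x‖ ≤ ε x) ∧ criticalSet g U = ∅ := by
  obtain ⟨b⟩ := hbasis
  obtain ⟨N, hN, hN₁, hNL⟩ := hnorm
  have := secondCountableTopology_of_unconditionalSchauderBasis b
  rcases U.eq_empty_or_nonempty with rfl | hne
  · exact ⟨f, hf, by simp, by simp, by simp [criticalSet]⟩
  obtain ⟨s, hs, ⟨θ, a, hθ⟩, C, hC⟩ := exists_isCutoff_isNearIdentity b hN hN₁ hNL
  have hε₂ : LocallyPosOn (fun x => ε x / 2) U := hε.div continuous_const fun _ => two_pos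
  obtain ⟨x, g, hg, hgU⟩ := exists_approx_fderiv_mem hθ hC hU hne hf hε₂
  obtain ⟨t, ht, hxt⟩ :=
    exists_countable_subset_componentsIn_span (countable_range (fderiv ℝ f ∘ x))
  obtain ⟨T, hT⟩ := exists_independentMod_span
    (not_finiteDimensional_of_unconditionalSchauderBasis b) F (hs.union ht)
  obtain ⟨ρ, hρ, hρU⟩ := exists_smul_norm_le hθ hU hne hε₂ T
  have hW : componentsIn F (Submodule.span ℝ s) ⊔ Submodule.span ℝ (range (fderiv ℝ f ∘ x)) ≤
      componentsIn F (Submodule.span ℝ (s ∪ t)) :=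
    sup_le (componentsIn_mono (Submodule.span_mono subset_union_left)) (Submodule.span_le.2
      fun _ h => componentsIn_mono (Submodule.span_mono subset_union_right) (hxt h))
  have hρT : ContDiffOn ℝ 1 (fun y => ρ y • T y) U := hρ.smul T.contDiff.contDiffOn
  have hdiff {h : E → F} (hh : ContDiffOn ℝ 1 h U) {y} (hy : y ∈ U) : DifferentiableAt ℝ h y :=
    (hh.contDiffAt (hU.mem_nhds hy)).differentiableAt one_ne_zero
  have hfderiv {y} (hy : y ∈ U) : fderiv ℝ (fun y => g y + ρ y • T y) y =
      fderiv ℝ g y + fderiv ℝ (fun y => ρ y • T y) y :=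
    fderiv_fun_add (hdiff hg hy) (hdiff hρT hy)
  refine ⟨fun y => g y + ρ y • T y, hg.add hρT, fun y hy => ?_, fun y hy => ?_,
    eq_empty_of_forall_notMem fun y ⟨hy, hcrit⟩ => hcrit ?_⟩
  · rw [norm_sub_rev, add_sub_right_comm, ← add_halves (ε y)]
    exact norm_add_le_of_le (hgU y hy).1 (hρU y hy).2.1
  · rw [norm_sub_rev, hfderiv hy, add_sub_right_comm, ← add_halves (ε y)]
    exact norm_add_le_of_le (hgU y hy).2.1 (hρU y hy).2.2.1
  · refine surjective_of_sub_smul_mem_componentsIn (hρU y hy).1 hT ?_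
    rw [hfderiv hy, add_sub_assoc]
    exact Submodule.add_mem _ (hW (hgU y hy).2.2)
      (hW (Submodule.mem_sup_left (hρU y hy).2.2.2))

end Main

theorem theorem3p1 {E : Type*} [NormedAddCommGroup E] [NormedSpace ℝ E] [CompleteSpace E]
    (hE : ¬ FiniteDimensional ℝ E)
    (hbasis : Nonempty (UnconditionalSchauderBasis ℕ ℝ E))
    (hnorm : ∃ N : Seminorm ℝ E,
      IsEquivalentNorm N ∧ IsC1Norm N ∧ LocallyDependsOnFinitelyManyCoordinates N)
    (d : ℕ) (U : Set E) (hU : IsOpen U)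
    (f : E → EuclideanSpace ℝ (Fin d)) (hf : ContDiffOn ℝ 1 f U)
    (ε : E → ℝ) (hε : ContinuousOn ε U) (hε_pos : ∀ x ∈ U, 0 < ε x) :
    ∃ g : E → EuclideanSpace ℝ (Fin d), ContDiffOn ℝ 1 g U ∧
      (∀ x ∈ U, ‖f x - g x‖ ≤ ε x) ∧
      (∀ x ∈ U, ‖fderiv ℝ f x - fderiv ℝ g x‖ ≤ ε x) ∧
      criticalSet g U = ∅ := by
  exact theorem3p1_general hbasis hnorm hU hf (locallyPosOn_of_continuousOn hU hε hε_pos)
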